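/- A BIDMC is a channel with uniformly distributed input in $\{0,1\}$ and a discrete output alphabet. The LR-profile of a BIDMC $W$ with output $y$ is $P_W(\varepsilon)=\Pr(y\in L_W(\varepsilon))$, $\varepsilon\in[0,1]$, where $L_W(\varepsilon)=\{b:\Pr(y=b\mid 0)/\Pr(y=b\mid 1)=\varepsilon/(1-\varepsilon)\}$; $W\cong W'$ means $P_W=P_{W'}$ on $[0,1]$. $W'$ is a degradation of $W$ if $W'$ is obtained by passing the output of $W$ through a further channel. $\mathrm{B}(\varepsilon)$ is the binary symmetric channel with crossover probability $\varepsilon$, and $\sum_j p_j\mathrm{B}(\varepsilon_j)$ (with $p_j\ge 0$, $\sum_j p_j=1$) is the channel that uses $\mathrm{B}(\varepsilon_j)$ with probability $p_j$ and reveals $j$ to the receiver. $I(W)=\sum_y\sum_{x}\frac12\Pr(y|x)\log_2\frac{\Pr(y|x)}{\frac12\Pr(y|0)+\frac12\Pr(y|1)}$ is the symmetric capacity. A particle $p\mathrm{B}(\varepsilon)$ is compounded from particles $r_a\mathrm{B}(\sigma_a)$, $\sigma_a\in[0,1/2]$, if $p=\sum_a r_a$ and $p\varepsilon=\sum_a r_a\sigma_a$.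 Let $2\le n<m$, $0\le\sigma_1<\dots<\sigma_m\le 1/2$, $q_1,\dots,q_m>0$, $\sum_i q_i=1$, and let $Q\cong\sum_{i=1}^m q_i\mathrm{B}(\sigma_i)$; put $q_0=q_{m+1}=0$. A $2n$-degradation of $Q$ is a degradation of $Q$ that is equivalent to some $\sum_{j=1}^n p_j\mathrm{B}(\varepsilon_j)$. A $2n$-P$^*$-degradation of $Q$ is a channel $\sum_{j=1}^n p_j\mathrm{B}(\varepsilon_j)$ with all $p_j>0$ and $\varepsilon_1<\dots<\varepsilon_n$ for which there are integers $0=i_1<i_2<\dots<i_{n+1}=m+1$ and numbers $0\le s_j\le q_{i_j}$ ($s_1=s_{n+1}=0$) such that for each $j\in\{1,\dots,n\}$ the particle $p_j\mathrm{B}(\varepsilon_j)$ is compounded from $s_j\mathrm{B}(\sigma_{i_j})$, $(q_{i_{j+1}}-s_{j+1})\mathrm{B}(\sigma_{i_{j+1}})$ and the $q_a\mathrm{B}(\sigma_a)$ with $i_j<a<i_{j+1}$, and such that, if $i_{j+1}=i_j+1$, then $s_j=0$ implies $s_{j+1}=0$, $p_j=q_{i_{j+1}}$, $\varepsilon_j=\sigma_{i_{j+1}}$,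 and $s_{j+1}=q_{i_{j+1}}$ implies $s_j=q_{i_j}=p_j$, $\varepsilon_j=\sigma_{i_j}$. Call a $2n$-degradation $W$ of $Q$ C-optimal if $I(W)\ge I(D)$ for every $2n$-P$^*$-degradation $D$ of $Q$. (In particular, every P$^*$-degradation of maximal symmetric capacity among the $2n$-P$^*$-degradations, and every $2n$-degradation of maximal symmetric capacity among all $2n$-degradations, is C-optimal.) Theorem. Let $W$ be a C-optimal $2n$-degradation of $Q$. Then there are integers $1=k_0<k_1<\dots<k_n=m+1$ such that $W\cong D_Q^+(k_1,\dots,k_{n-1})=\sum_{j=1}^n p_j\mathrm{B}(\varepsilon_j)$, where for each $j\in\{1,\dots,n\}$ the particle $p_j\mathrm{B}(\varepsilon_j)$ is compounded from the particles $q_i\mathrm{B}(\sigma_i)$, $k_{j-1}\le i<k_j$; and for each $j\in\{1,\dots,n-1\}$ with $\varepsilon_j>0$, $$\sigma_{k_j-1}<\phi(\varepsilon_j,\varepsilon_{j+1})<\sigma_{k_j},\qquad \phi(\varepsilon_1,\varepsilon_2)=\frac{\ln(\overline{\varepsilon_1}/\overline{\varepsilon_2})}{\ln\big(\overline{\varepsilon_1}\varepsilon_2/(\overline{\varepsilon_2}\varepsilon_1)\big)},\quad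 \overline{\varepsilon}=1-\varepsilon.$$ -/

import Mathlib

open Finset

/-- A channel from `X` to a discrete output alphabet `Y`: `prob a y` is `Pr(y | x = a)`. -/
structure Channel (X Y : Type*) where
  /-- the transition probabilities -/
  prob : X → Y → ℝ
  nonneg : ∀ a y, 0 ≤ prob a y
  hasSum_one : ∀ a, HasSum (prob a) 1

/-- Binary-input discrete memoryless channels with output alphabet `Y`. -/
abbrev BIDMC (Y : Type*) := Channel (Fin 2) Y

namespace Channel

/-- `Pr(y)` for a uniformly distributed input. -/
noncomputable def outputProb {Y : Type*} (W : BIDMC Y) (y : Y) : ℝ :=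
  (W.prob 0 y + W.prob 1 y) / 2

/-- The outputs whose likelihood ratio `Pr(y | 0) / Pr(y | 1)` is `e / (1 - e)`. The equation is
cross-multiplied, so that `e = 1` stands for an infinite ratio. (An output that occurs with
probability zero for both inputs has no likelihood ratio; it belongs to every level set, where it
has no weight.) -/
def lrLevel {Y : Type*} (W : BIDMC Y) (e : ℝ) : Set Y :=
  {y | (1 - e) * W.prob 0 y = e * W.prob 1 y}

/-- The LR-profile `P_W(e) = Pr(y ∈ L_W(e))`. -/
noncomputable def lrProfile {Y : Type*} (W : BIDMC Y) (e : ℝ) : ℝ :=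
  ∑' y, (W.lrLevel e).indicator W.outputProb y

/-- Equivalence of BIDMCs: their LR-profiles coincide on `[0, 1]`. -/
def Equivalent {Y Z : Type*} (W : BIDMC Y) (V : BIDMC Z) : Prop :=
  ∀ e ∈ Set.Icc (0 : ℝ) 1, W.lrProfile e = V.lrProfile e

/-- `W.IsDegradationOf V`: `W` arises from `V` by an intermediate channel applied to the output. -/
def IsDegradationOf {Y Z : Type*} (W : BIDMC Y) (V : BIDMC Z) : Prop :=
  ∃ K : Channel Z Y, ∀ a y, W.prob a y = ∑' z, V.prob a z * K.prob z y

/-- The symmetric capacity `I(W)`. -/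
noncomputable def symmCapacity {Y : Type*} (W : BIDMC Y) : ℝ :=
  ∑' y, ∑ x : Fin 2, 1 / 2 * W.prob x y *
    Real.logb 2 (W.prob x y / (1 / 2 * W.prob 0 y + 1 / 2 * W.prob 1 y))

/-- The binary symmetric channel `B(e)` with crossover probability `e`. -/
noncomputable def bsc (e : Set.Icc (0 : ℝ) 1) : BIDMC (Fin 2) where
  prob a b := if a = b then 1 - (e : ℝ) else (e : ℝ)
  nonneg a b := by
    have h0 := e.2.1
    have h1 := e.2.2
    split_ifs <;> linarith
  hasSum_one a := by
    have h := hasSum_fintype (fun b : Fin 2 => if a = b then 1 - (e : ℝ) else (e : ℝ))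
    have h2 : ∑ b : Fin 2, (if a = b then 1 - (e : ℝ) else (e : ℝ)) = 1 := by
      fin_cases a <;> simp [Fin.sum_univ_two]
    rwa [h2] at h

/-- The random switching channel `∑ j, p j • W j`: the sub-channel `W j` is used with probability
`p j`, and the receiver sees which sub-channel was used. -/
noncomputable def rsc {n : ℕ} {Y : Type*} (p : stdSimplex ℝ (Fin n)) (W : Fin n → BIDMC Y) :
    BIDMC (Fin n × Y) where
  prob a z := p.1 z.1 * (W z.1).prob a z.2
  nonneg a z := mul_nonneg (p.2.1 z.1) ((W z.1).nonneg a z.2)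
  hasSum_one a := by
    have hf : ∀ j, HasSum (fun y => p.1 j * (W j).prob a y) (p.1 j) := fun j => by
      simpa using ((W j).hasSum_one a).mul_left (p.1 j)
    have hs : Summable (fun z : Fin n × Y => p.1 z.1 * (W z.1).prob a z.2) := by
      refine (summable_prod_of_nonneg
        (fun z => mul_nonneg (p.2.1 z.1) ((W z.1).nonneg a z.2))).2 ⟨fun j => (hf j).summable, ?_⟩
      exact (hasSum_fintype _).summable
    have h := hs.hasSum
    rw [hs.tsum_prod' fun j => (hf j).summable] at h
    have e : ∑' j, ∑' y, p.1 j * (W j).prob a y = 1 := by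
      simp_rw [fun j => (hf j).tsum_eq]
      rw [tsum_fintype]
      exact p.2.2
    rwa [e] at h

/-- `∑ j, p j • B(ε j)`. -/
noncomputable def bscMix {n : ℕ} (p : stdSimplex ℝ (Fin n)) (ε : Fin n → Set.Icc (0 : ℝ) 1) :
    BIDMC (Fin n × Fin 2) :=
  rsc p fun j => bsc (ε j)

/-- `W` is equivalent to a random switching channel of `n` binary symmetric channels. (Such a
channel is symmetric.) -/
def IsBSCMixture {Y : Type*} (n : ℕ) (W : BIDMC Y) : Prop :=
  ∃ (p : stdSimplex ℝ (Fin n)) (ε : Fin n → Set.Icc (0 : ℝ) 1), W.Equivalent (bscMix p ε)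

end Channel

/-- The `a`-th entry `x_a` of the list `x_1, …, x_m`, with `x_a = 0` for `a = 0` and `a > m`. -/
noncomputable def nth {m : ℕ} (x : Fin m → ℝ) (a : ℕ) : ℝ :=
  if h : 1 ≤ a ∧ a ≤ m then x ⟨a - 1, by omega⟩ else 0

/-- The particle `p B(ε)` is compounded from the particles `k a • B(σ a)`, `a ∈ S`. -/
def IsCompounded (p ε : ℝ) (S : Finset ℕ) (k σ : ℕ → ℝ) : Prop :=
  (∀ a ∈ S, 0 ≤ σ a ∧ σ a ≤ 1 / 2) ∧ p = ∑ a ∈ S, k a ∧ p * ε = ∑ a ∈ S, k a * σ a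

/-- The weights of the `(l, l'; t, t')`-segment of a channel with weights `q`: weight `t` at `l`,
weight `q l' - t'` at `l'`, and full weights in between. -/
noncomputable def segmentWeight (q : ℕ → ℝ) (l l' : ℕ) (t t' : ℝ) (a : ℕ) : ℝ :=
  if a = l then t else if a = l' then q l' - t' else if l < a ∧ a < l' then q a else 0

/-- `∑ j, p j • B(ε j)` is a `2n`-P*-degradation of `∑ i, q i • B(σ i)`. The boundary between the
consecutive particles `j - 1` and `j` has the splitting pattern `(i j, s j)`: the weight of the
particle number `i j` is divided, `s j` of it going to the upper side. -/
def IsPStarDegradation {m n : ℕ} (q σ : Fin m → ℝ) (p ε : Fin n → ℝ) : Prop :=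
  ∃ (i : Fin (n + 1) → ℕ) (s : Fin (n + 1) → ℝ),
    i 0 = 0 ∧ i (Fin.last n) = m + 1 ∧ StrictMono i ∧
    s 0 = 0 ∧ s (Fin.last n) = 0 ∧ (∀ j, 0 ≤ s j ∧ s j ≤ nth q (i j)) ∧
    (∀ j : Fin n, IsCompounded (p j) (ε j) (Icc (i j.castSucc) (i j.succ))
      (segmentWeight (nth q) (i j.castSucc) (i j.succ) (s j.castSucc) (s j.succ)) (nth σ)) ∧
    (∀ j, 0 < p j) ∧ StrictMono ε ∧
    ∀ j : Fin n, i j.succ = i j.castSucc + 1 →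
      (s j.castSucc = 0 →
        s j.succ = 0 ∧ p j = nth q (i j.succ) ∧ ε j = nth σ (i j.succ)) ∧
      (s j.succ = nth q (i j.succ) →
        s j.castSucc = nth q (i j.castSucc) ∧
          p j = nth q (i j.castSucc) ∧ ε j = nth σ (i j.castSucc))

/-- `W` is a C-optimal `2n`-degradation of `Q`, where `Q` is equivalent to `∑ i, q i • B(σ i)`: it
is a degradation of `Q`, equivalent to a random switching channel of `n` binary symmetric channels,
and no `2n`-P*-degradation of `Q` has a larger symmetric capacity (a smaller capacity-loss rate).
`W` is not required to be a P*-degradation itself. Hence both the P*-degradations of least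
capacity-loss rate among all P*-degradations, and the `2n`-degradations of greatest symmetric
capacity among all `2n`-degradations, are C-optimal in this sense. -/
def IsCOptimal {m : ℕ} {X Y : Type*} (n : ℕ) (q : stdSimplex ℝ (Fin m))
    (σ : Fin m → Set.Icc (0 : ℝ) 1) (Q : BIDMC X) (W : BIDMC Y) : Prop :=
  W.IsBSCMixture n ∧ W.IsDegradationOf Q ∧
    ∀ (p : stdSimplex ℝ (Fin n)) (ε : Fin n → Set.Icc (0 : ℝ) 1),
      IsPStarDegradation q.1 (fun i => (σ i : ℝ)) p.1 (fun j => (ε j : ℝ)) →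
        (Channel.bscMix p ε).symmCapacity ≤ W.symmCapacity

/-- `∑ j, p j • B(ε j)` is the channel `D⁺(k 1, …, k (n - 1))` of `∑ i, q i • B(σ i)`: its `j`-th
particle is compounded from the particles with numbers from `k (j - 1)` to `k j - 1`. -/
def IsDPlus {m n : ℕ} (q σ : Fin m → ℝ) (k : Fin (n + 1) → ℕ) (p ε : Fin n → ℝ) : Prop :=
  ∀ j : Fin n,
    IsCompounded (p j) (ε j) (Ico (k j.castSucc) (k j.succ)) (nth q) (nth σ)

/-- The function `φ(ε₁, ε₂)`. -/
noncomputable def phi (e₁ e₂ : ℝ) : ℝ :=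
  Real.log ((1 - e₁) / (1 - e₂)) / Real.log (((1 - e₁) * e₂) / ((1 - e₂) * e₁))

/-! Let h be the negative binary entropy in nats. A mixture of the B(ε_j) has capacity 1 + Σ p_j
h(ε_j) / ln 2, so maximizing capacity is a clustering problem for the points σ_i with weights q_i.
The tangent T_e of the convex function h is affine and lies below h, and T_e(x) = h(x) only for e =
x. Hence the value of a clustering is Σ q_i T_e(σ_i), with e the barycenter of the cluster of i, and
other centers give no more.

A degradation of Q yields a mean-preserving transport from the outputs of Q to those of W
(`IsDegradationOf.exists_transport`). Folding the two outputs of each B(ε) onto [0, 1/2] turns it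
into a fractional clustering whose barycenters lie at or below its centers. Tangents at e ≤ 1/2 do
not increase, so the value of W is at most the transported tangent sum. That sum only grows when
each σ_i goes to its best tangent, and the result is bounded by the value of a genuine clustering.
Conversely, the best clustering, once sorted, is a P*-degradation, so C-optimality forces equality
throughout (`exists_isMaxClustering_of_transport`).

The rest is rigidity: in a best clustering each point strictly prefers its own center
(`IsMaxClustering.negCrossEntropy_lt`). Therefore the transport splits no point, the clusters are
intervals, and neighboring clusters are separated by the crossing φ of their tangents. -/

/-! ### Tangents of the negative binary entropy. -/

/-- The tangent at `e` of the negative binary entropy function, evaluated at `x`. -/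
noncomputable def negCrossEntropy (e x : ℝ) : ℝ :=
  x * Real.log e + (1 - x) * Real.log (1 - e)

/-- Apply log t ≤ t - 1 to e/x and (1-e)/(1-x); the linear terms cancel. Since `Real.log 0 = 0`, a
center e = 0 would give 0 instead of -∞ for x > 0. The hypothesis `h` excludes this, and the same
admissibility condition recurs below. -/
theorem negCrossEntropy_lt_self {e x : ℝ} (he0 : 0 ≤ e) (he : e < 1) (hx0 : 0 ≤ x) (hx : x < 1)
    (h : e = 0 → x = 0) (hne : e ≠ x) : negCrossEntropy e x < negCrossEntropy x x := by
  unfold negCrossEntropy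
  have h1 : x * Real.log e - x * Real.log x ≤ e - x := by
    rcases hx0.eq_or_lt with rfl | hx0
    · simpa using he0
    · have he0' : 0 < e := lt_of_le_of_ne he0 fun h' => hx0.ne' (h h'.symm)
      have := Real.log_le_sub_one_of_pos (div_pos he0' hx0)
      rw [Real.log_div he0'.ne' hx0.ne'] at this
      have h2 := mul_le_mul_of_nonneg_left this hx0.le
      have h3 : x * (e / x - 1) = e - x := by field_simp
      linarith
  have h2 : (1 - x) * Real.log (1 - e) - (1 - x) * Real.log (1 - x) < x - e := by
    have hx' : 0 < 1 - x := by linarith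
    have he' : 0 < 1 - e := by linarith
    have := Real.log_lt_sub_one_of_pos (div_pos he' hx') (by
      rw [Ne, div_eq_one_iff_eq hx'.ne']
      intro h'
      exact hne (by linarith))
    rw [Real.log_div he'.ne' hx'.ne'] at this
    have h2 := mul_lt_mul_of_pos_left this hx'
    have h3 : (1 - x) * ((1 - e) / (1 - x) - 1) = x - e := by field_simp; ring
    linarith
  linarith

theorem negCrossEntropy_le_self {e x : ℝ} (he0 : 0 ≤ e) (he : e < 1) (hx0 : 0 ≤ x) (hx : x < 1)
    (h : e = 0 → x = 0) : negCrossEntropy e x ≤ negCrossEntropy x x := by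
  by_cases hne : e = x
  · rw [hne]
  · exact (negCrossEntropy_lt_self he0 he hx0 hx h hne).le

theorem negCrossEntropy_sub {e x y : ℝ} :
    negCrossEntropy e x - negCrossEntropy e y
      = (x - y) * (Real.log e - Real.log (1 - e)) := by
  unfold negCrossEntropy
  ring

theorem log_sub_log_one_sub_nonpos {e : ℝ} (he0 : 0 ≤ e) (he : e ≤ 1 / 2) :
    Real.log e - Real.log (1 - e) ≤ 0 := by
  rcases he0.eq_or_lt with rfl | he0
  · simp
  · exact sub_nonpos.2 (Real.log_le_log he0 (by linarith))

theorem log_sub_log_one_sub_lt {e e' : ℝ} (he0 : 0 < e) (h : e < e') (he' : e' < 1) :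
    Real.log e - Real.log (1 - e) < Real.log e' - Real.log (1 - e') := by
  have h1 := Real.log_lt_log he0 h
  have h2 := Real.log_lt_log (by linarith : (0 : ℝ) < 1 - e') (by linarith : 1 - e' < 1 - e)
  linarith

/-- The two tangents cross at `phi e e'`, and slopes increase with the point of tangency, so the
tangent at the smaller point is the higher one to the left of the crossing. -/
theorem negCrossEntropy_lt_iff_lt_phi {e e' x : ℝ} (he0 : 0 < e) (h : e < e') (he' : e' < 1) :
    negCrossEntropy e' x < negCrossEntropy e x ↔ x < phi e e' := by
  have hlt := log_sub_log_one_sub_lt he0 h he'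
  have a1 : (1 - e) ≠ 0 := by linarith
  have a2 : (1 - e') ≠ 0 := by linarith
  have a3 : e' ≠ 0 := by linarith
  unfold phi negCrossEntropy
  rw [Real.log_div a1 a2, Real.log_div (mul_ne_zero a1 a3) (mul_ne_zero a2 he0.ne'),
    Real.log_mul a1 a3, Real.log_mul a2 he0.ne', lt_div_iff₀ (by linarith)]
  constructor <;> intro h <;> linarith

theorem lt_negCrossEntropy_iff_phi_lt {e e' x : ℝ} (he0 : 0 < e) (h : e < e') (he' : e' < 1) :
    negCrossEntropy e x < negCrossEntropy e' x ↔ phi e e' < x := by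
  have hlt := log_sub_log_one_sub_lt he0 h he'
  have a1 : (1 - e) ≠ 0 := by linarith
  have a2 : (1 - e') ≠ 0 := by linarith
  have a3 : e' ≠ 0 := by linarith
  unfold phi negCrossEntropy
  rw [Real.log_div a1 a2, Real.log_div (mul_ne_zero a1 a3) (mul_ne_zero a2 he0.ne'),
    Real.log_mul a1 a3, Real.log_mul a2 he0.ne', div_lt_iff₀ (by linarith)]
  constructor <;> intro h <;> linarith

/-! ### Clusterings of weighted points and the rigidity of the best ones. -/

section Clustering

variable {ι κ : Type*} [Fintype ι] [DecidableEq κ]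

/-- The total weight of the cluster `j` of the clustering `s`. -/
noncomputable def clusterMass (q : ι → ℝ) (s : ι → κ) (j : κ) : ℝ :=
  ∑ i with s i = j, q i

/-- The barycenter of the cluster `j` of the clustering `s`. -/
noncomputable def clusterMean (q σ : ι → ℝ) (s : ι → κ) (j : κ) : ℝ :=
  clusterMass (fun i => q i * σ i) s j / clusterMass q s j

/-- The negative conditional entropy left by the clustering `s`. -/
noncomputable def clusterValue [Fintype κ] (q σ : ι → ℝ) (s : ι → κ) : ℝ :=
  ∑ j, clusterMass q s j * negCrossEntropy (clusterMean q σ s j) (clusterMean q σ s j)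

/-- The clustering `s` has the largest value among all clusterings with the same labels. -/
def IsMaxClustering [Fintype κ] (q σ : ι → ℝ) (s : ι → κ) : Prop :=
  ∀ s' : ι → κ, clusterValue q σ s' ≤ clusterValue q σ s

variable {q σ : ι → ℝ} (hq : ∀ i, 0 < q i) (h0 : ∀ i, 0 ≤ σ i) (h1 : ∀ i, σ i ≤ 1 / 2)
  {s : ι → κ}

include hq in
theorem clusterMass_nonneg (j : κ) : 0 ≤ clusterMass q s j :=
  sum_nonneg fun i _ => (hq i).le

include hq in
theorem clusterMass_pos (i : ι) : 0 < clusterMass q s (s i) :=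
  sum_pos (fun i _ => hq i) ⟨i, by simp⟩

include hq in
theorem clusterMass_mul_clusterMean (j : κ) :
    clusterMass q s j * clusterMean q σ s j = clusterMass (fun i => q i * σ i) s j := by
  unfold clusterMean
  by_cases h : ∃ i, s i = j
  · obtain ⟨i, rfl⟩ := h
    exact mul_div_cancel₀ _ (clusterMass_pos hq i).ne'
  · push Not at h
    have : ∀ w : ι → ℝ, clusterMass w s j = 0 := fun w => by simp [clusterMass, h]
    simp [this]

include hq h0 in
theorem clusterMean_nonneg (j : κ) : 0 ≤ clusterMean q σ s j :=
  div_nonneg (sum_nonneg fun i _ => mul_nonneg (hq i).le (h0 i)) (clusterMass_nonneg hq j)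

include hq h1 in
theorem clusterMean_le (j : κ) : clusterMean q σ s j ≤ 1 / 2 := by
  refine div_le_of_le_mul₀ (clusterMass_nonneg hq j) (by norm_num) ?_
  unfold clusterMass
  rw [mul_sum]
  exact sum_le_sum fun i _ => by nlinarith [hq i, h1 i]

include hq h0 in
theorem eq_zero_of_clusterMean_eq_zero {i : ι} (h : clusterMean q σ s (s i) = 0) : σ i = 0 := by
  have h2 := clusterMass_mul_clusterMean (σ := σ) hq (s := s) (s i)
  rw [h, mul_zero, clusterMass, eq_comm,
    sum_eq_zero_iff_of_nonneg fun i _ => mul_nonneg (hq i).le (h0 i)] at h2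
  exact (mul_eq_zero.1 (h2 i (by simp))).resolve_left (hq i).ne'

include hq h0 h1 in
theorem clusterMass_mul_negCrossEntropy_le {e : κ → ℝ} (he0 : ∀ j, 0 ≤ e j)
    (he1 : ∀ j, e j ≤ 1 / 2) (had : ∀ i, e (s i) = 0 → σ i = 0) (j : κ) :
    clusterMass q s j * negCrossEntropy (e j) (clusterMean q σ s j)
      ≤ clusterMass q s j * negCrossEntropy (clusterMean q σ s j) (clusterMean q σ s j) ∧
    (clusterMass q s j * negCrossEntropy (e j) (clusterMean q σ s j)
      = clusterMass q s j * negCrossEntropy (clusterMean q σ s j) (clusterMean q σ s j) →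
      clusterMass q s j ≠ 0 → e j = clusterMean q σ s j) := by
  have b0 := clusterMean_nonneg hq h0 (s := s) j
  have b1 := clusterMean_le hq h1 (s := s) j
  have a0 := he0 j
  have a1 := he1 j
  have had' : e j = 0 → clusterMean q σ s j = 0 := fun h => by
    rw [clusterMean, clusterMass, sum_eq_zero, zero_div]
    intro i hi
    rw [had i (by rw [(mem_filter.1 hi).2, h]), mul_zero]
  refine ⟨mul_le_mul_of_nonneg_left (negCrossEntropy_le_self a0 (by linarith) b0 (by linarith)
    had') (clusterMass_nonneg hq j), fun h hm => ?_⟩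
  by_contra hne
  exact (negCrossEntropy_lt_self a0 (by linarith) b0 (by linarith) had' hne).ne
    (mul_left_cancel₀ hm h)

theorem clusterMass_perm (w : ι → ℝ) (π : Equiv.Perm κ) (j : κ) :
    clusterMass w (π.symm ∘ s) j = clusterMass w s (π j) := by
  simp [clusterMass, Equiv.symm_apply_eq]

theorem clusterMean_perm (π : Equiv.Perm κ) (j : κ) :
    clusterMean q σ (π.symm ∘ s) j = clusterMean q σ s (π j) := by
  simp [clusterMean, clusterMass_perm]

variable [Fintype κ]

theorem sum_clusterMass : ∑ j, clusterMass q s j = ∑ i, q i :=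
  sum_fiberwise _ _ _

include hq in
-- Tangents are affine, so a cluster enters only through its mass and barycenter.
theorem sum_mul_negCrossEntropy (e : κ → ℝ) :
    ∑ i, q i * negCrossEntropy (e (s i)) (σ i)
      = ∑ j, clusterMass q s j * negCrossEntropy (e j) (clusterMean q σ s j) := by
  rw [← sum_fiberwise univ s]
  refine sum_congr rfl fun j _ => ?_
  have h2 := clusterMass_mul_clusterMean (σ := σ) hq (s := s) j
  have h3 : clusterMass q s j * negCrossEntropy (e j) (clusterMean q σ s j)
      = clusterMass (fun i => q i * σ i) s j * (Real.log (e j) - Real.log (1 - e j))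
        + clusterMass q s j * Real.log (1 - e j) := by
    rw [← h2, negCrossEntropy]
    ring
  rw [h3, clusterMass, clusterMass, sum_mul, sum_mul, ← sum_add_distrib]
  refine sum_congr rfl fun i hi => ?_
  rw [(mem_filter.1 hi).2, negCrossEntropy]
  ring

include hq in
theorem clusterValue_eq_sum :
    clusterValue q σ s = ∑ i, q i * negCrossEntropy (clusterMean q σ s (s i)) (σ i) :=
  (sum_mul_negCrossEntropy hq _).symm

include hq h0 h1 in
theorem sum_negCrossEntropy_le_clusterValue {e : κ → ℝ} (he0 : ∀ j, 0 ≤ e j)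
    (he1 : ∀ j, e j ≤ 1 / 2) (had : ∀ i, e (s i) = 0 → σ i = 0) :
    ∑ i, q i * negCrossEntropy (e (s i)) (σ i) ≤ clusterValue q σ s := by
  rw [sum_mul_negCrossEntropy hq]
  exact sum_le_sum fun j _ => (clusterMass_mul_negCrossEntropy_le hq h0 h1 he0 he1 had j).1

include hq h0 h1 in
-- Equality in a sum of termwise inequalities is equality in each term. Only labels in the image of
-- `s` are controlled, because an empty cluster has mass zero.
theorem eq_clusterMean_of_clusterValue_le {e : κ → ℝ} (he0 : ∀ j, 0 ≤ e j)
    (he1 : ∀ j, e j ≤ 1 / 2) (had : ∀ i, e (s i) = 0 → σ i = 0)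
    (hle : clusterValue q σ s ≤ ∑ i, q i * negCrossEntropy (e (s i)) (σ i)) (i : ι) :
    e (s i) = clusterMean q σ s (s i) := by
  have h := clusterMass_mul_negCrossEntropy_le hq h0 h1 he0 he1 had
  have heq := le_antisymm (sum_negCrossEntropy_le_clusterValue hq h0 h1 he0 he1 had) hle
  rw [sum_mul_negCrossEntropy hq, clusterValue,
    sum_eq_sum_iff_of_le fun j _ => (h j).1] at heq
  exact (h (s i)).2 (heq (s i) (mem_univ _)) (clusterMass_pos hq i).ne'

theorem exists_isMaxClustering [Nonempty κ] (q σ : ι → ℝ) :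
    ∃ s : ι → κ, IsMaxClustering q σ s := by
  obtain ⟨s, hs⟩ := Finite.exists_max fun s : ι → κ => clusterValue q σ s
  exact ⟨s, hs⟩

include hq h0 h1 in
-- With a label unused, two distinct points share a cluster. Either one can move to the free label
-- with a copy of its old center at no loss; by optimality that center is then the barycenter of a
-- singleton. So both points equal the same center.
theorem IsMaxClustering.surjective (hσ : Function.Injective σ)
    (hcard : Fintype.card κ < Fintype.card ι) (hs : IsMaxClustering q σ s) :
    Function.Surjective s := by
  classical
  intro j
  by_contra! hj
  obtain ⟨i, i', hne, heq⟩ := Fintype.exists_ne_map_eq_of_card_lt s hcard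
  have key : ∀ i i', i ≠ i' → s i = s i' → clusterMean q σ s (s i) = σ i := by
    intro i i' hne heq
    set e : κ → ℝ := Function.update (clusterMean q σ s) j (clusterMean q σ s (s i)) with he
    set s' : ι → κ := Function.update s i j with hs'
    have hes : ∀ l, e (s' l) = clusterMean q σ s (s l) := fun l => by
      by_cases hl : l = i
      · subst hl
        simp [he, hs']
      · simp [he, hs', Function.update_of_ne hl, Function.update_of_ne (hj l)]
    have he' : ∀ l, ∃ l', e l = clusterMean q σ s l' := fun l => by
      by_cases hl : l = j
      · exact ⟨s i, by simp [he, hl]⟩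
      · exact ⟨l, by simp [he, Function.update_of_ne hl]⟩
    have := eq_clusterMean_of_clusterValue_le hq h0 h1 (s := s') (e := e)
      (fun l => by obtain ⟨l', h⟩ := he' l; rw [h]; exact clusterMean_nonneg hq h0 l')
      (fun l => by obtain ⟨l', h⟩ := he' l; rw [h]; exact clusterMean_le hq h1 l')
      (fun l h => eq_zero_of_clusterMean_eq_zero hq h0 (by rw [← hes l, h]))
      (by simp_rw [hes]; rw [← clusterValue_eq_sum hq]; exact hs s') i
    rw [hes] at this
    rw [this]
    have hf : (univ.filter fun l => s' l = s' i) = {i} := by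
      ext l
      by_cases hl : l = i
      · simp [hl]
      · simp [hs', hj l, hl]
    rw [clusterMean, clusterMass, clusterMass, hf]
    simp [(hq i).ne']
  exact hne (hσ (by rw [← key i i' hne heq, ← key i' i hne.symm heq.symm, heq]))

include hq h0 h1 in
-- Merging two clusters with the same barycenter costs nothing but leaves a label unused, which no
-- best clustering does.
theorem IsMaxClustering.clusterMean_injective (hσ : Function.Injective σ)
    (hcard : Fintype.card κ < Fintype.card ι) (hs : IsMaxClustering q σ s) :
    Function.Injective (clusterMean q σ s) := by
  intro j j' hjj
  by_contra hne
  set s' : ι → κ := fun i => if s i = j' then j else s i with hs'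
  have hes : ∀ i, clusterMean q σ s (s' i) = clusterMean q σ s (s i) := fun i => by
    by_cases h : s i = j'
    · simp [hs', h, hjj]
    · simp [hs', h]
  have hle := sum_negCrossEntropy_le_clusterValue hq h0 h1 (s := s') (e := clusterMean q σ s)
    (fun l => clusterMean_nonneg hq h0 l) (fun l => clusterMean_le hq h1 l)
    (fun l h => eq_zero_of_clusterMean_eq_zero hq h0 (by rw [← hes l, h]))
  simp_rw [hes] at hle
  rw [← clusterValue_eq_sum hq] at hle
  obtain ⟨i, hi⟩ := IsMaxClustering.surjective hq h0 h1 hσ hcard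
    (fun s'' => (hs s'').trans hle : IsMaxClustering q σ s') j'
  by_cases h : s i = j'
  · simp only [hs', h, if_true] at hi
    exact hne hi
  · simp only [hs', h, if_false] at hi

include hq h0 h1 in
-- Otherwise moving `i` to `j` with the centers kept gives another best clustering, so no barycenter
-- moves. But cluster `j` gained `i` and the cluster of `i` lost it, so both barycenters equal `σ
-- i`, against injectivity.
theorem IsMaxClustering.negCrossEntropy_lt (hσ : Function.Injective σ)
    (hcard : Fintype.card κ < Fintype.card ι) (hs : IsMaxClustering q σ s) {i : ι} {j : κ}
    (hj : j ≠ s i) (had : clusterMean q σ s j = 0 → σ i = 0) :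
    negCrossEntropy (clusterMean q σ s j) (σ i)
      < negCrossEntropy (clusterMean q σ s (s i)) (σ i) := by
  classical
  by_contra! hle
  set s' : ι → κ := Function.update s i j with hs'
  have had' : ∀ l, clusterMean q σ s (s' l) = 0 → σ l = 0 := fun l h => by
    by_cases hl : l = i
    · subst hl
      exact had (by simpa [hs'] using h)
    · exact eq_zero_of_clusterMean_eq_zero hq h0
        (by simpa [hs', Function.update_of_ne hl] using h)
  have hsum : clusterValue q σ s
      ≤ ∑ l, q l * negCrossEntropy (clusterMean q σ s (s' l)) (σ l) := by
    rw [clusterValue_eq_sum hq]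
    refine sum_le_sum fun l _ => mul_le_mul_of_nonneg_left ?_ (hq l).le
    by_cases hl : l = i
    · subst hl
      simpa [hs'] using hle
    · simp [hs', Function.update_of_ne hl]
  have hmax : IsMaxClustering q σ s' := fun s'' => (hs s'').trans (hsum.trans
    (sum_negCrossEntropy_le_clusterValue hq h0 h1 (fun l => clusterMean_nonneg hq h0 l)
      (fun l => clusterMean_le hq h1 l) had'))
  have hsurj := IsMaxClustering.surjective hq h0 h1 hσ hcard hmax
  -- The old centers are still optimal for `s'`; surjectivity ensures that the equality case reaches
  -- every label.
  have heq : ∀ l, clusterMean q σ s l = clusterMean q σ s' l := fun l => by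
    obtain ⟨i', rfl⟩ := hsurj l
    exact eq_clusterMean_of_clusterValue_le hq h0 h1 (fun l => clusterMean_nonneg hq h0 l)
      (fun l => clusterMean_le hq h1 l) had' ((hs s').trans hsum) i'
  have hm : ∀ w : ι → ℝ, clusterMass w s' j = clusterMass w s j + w i := fun w => by
    have : (univ.filter fun l => s' l = j) = insert i (univ.filter fun l => s l = j) := by
      ext l
      by_cases hl : l = i
      · simp [hl, hs']
      · simp [hs', hl]
    rw [clusterMass, this, sum_insert (by simpa using hj.symm), clusterMass, add_comm]
  have hm' : ∀ w : ι → ℝ, clusterMass w s (s i) = clusterMass w s' (s i) + w i := fun w => by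
    have : (univ.filter fun l => s l = s i) = insert i (univ.filter fun l => s' l = s i) := by
      ext l
      by_cases hl : l = i
      · simp [hl]
      · simp [hs', hl]
    rw [clusterMass, this, sum_insert (by simpa [hs'] using hj), clusterMass, add_comm]
  have e1 := clusterMass_mul_clusterMean (σ := σ) hq (s := s) j
  have e2 := clusterMass_mul_clusterMean (σ := σ) hq (s := s') j
  have e3 := clusterMass_mul_clusterMean (σ := σ) hq (s := s) (s i)
  have e4 := clusterMass_mul_clusterMean (σ := σ) hq (s := s') (s i)
  rw [hm, hm, ← heq, ← e1] at e2
  rw [hm', hm', ← e4, ← heq] at e3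
  have a1 : clusterMean q σ s j = σ i := mul_left_cancel₀ (hq i).ne' (by linarith)
  have a2 : clusterMean q σ s (s i) = σ i := mul_left_cancel₀ (hq i).ne' (by linarith)
  exact hj (IsMaxClustering.clusterMean_injective hq h0 h1 hσ hcard hs (a1.trans a2.symm))

include hq h0 h1 in
-- Exchange argument: if the centers were in the opposite order, adding the two strict preferences
-- would contradict the monotonicity of the tangent slopes.
theorem IsMaxClustering.clusterMean_lt (hσ : Function.Injective σ)
    (hcard : Fintype.card κ < Fintype.card ι) (hs : IsMaxClustering q σ s) {i i' : ι}
    (hi : σ i < σ i') (hne : s i ≠ s i') :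
    clusterMean q σ s (s i) < clusterMean q σ s (s i') := by
  by_contra! hle
  have hlt : clusterMean q σ s (s i') < clusterMean q σ s (s i) := lt_of_le_of_ne hle fun h =>
    hne (IsMaxClustering.clusterMean_injective hq h0 h1 hσ hcard hs h.symm)
  have hpos : 0 < clusterMean q σ s (s i') :=
    lt_of_le_of_ne (clusterMean_nonneg hq h0 _) fun h => by
      have := eq_zero_of_clusterMean_eq_zero hq h0 h.symm
      linarith [h0 i]
  have l1 := IsMaxClustering.negCrossEntropy_lt hq h0 h1 hσ hcard hs (i := i) hne.symm
    fun h => absurd h hpos.ne'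
  have l2 := IsMaxClustering.negCrossEntropy_lt hq h0 h1 hσ hcard hs (i := i') hne
    fun h => absurd h (hpos.trans hlt).ne'
  have l3 := log_sub_log_one_sub_lt hpos hlt
    (by linarith [clusterMean_le hq h1 (s := s) (s i)])
  have e1 := negCrossEntropy_sub (e := clusterMean q σ s (s i)) (x := σ i') (y := σ i)
  have e2 := negCrossEntropy_sub (e := clusterMean q σ s (s i')) (x := σ i') (y := σ i)
  nlinarith

theorem clusterValue_perm (π : Equiv.Perm κ) :
    clusterValue q σ (π.symm ∘ s) = clusterValue q σ s := by
  unfold clusterValue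
  simp_rw [clusterMass_perm, clusterMean_perm]
  exact Equiv.sum_comp π fun j =>
    clusterMass q s j * negCrossEntropy (clusterMean q σ s j) (clusterMean q σ s j)

/-- If a fractional clustering, whose centers lie above the barycenters of its clusters, is at
least as good as the best clustering, then it is a best clustering. -/
theorem exists_isMaxClustering_of_transport (hq : ∀ i, 0 < q i) (h0 : ∀ i, 0 ≤ σ i)
    (h1 : ∀ i, σ i ≤ 1 / 2) (hσ : Function.Injective σ)
    (hcard : Fintype.card κ < Fintype.card ι) {t : κ → ι → ℝ} {p e : κ → ℝ}
    (ht : ∀ j i, 0 ≤ t j i) (he0 : ∀ j, 0 ≤ e j) (he1 : ∀ j, e j ≤ 1 / 2)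
    (hp : ∀ j, ∑ i, t j i = p j) (hcol : ∀ i, ∑ j, t j i = q i)
    (hmean : ∀ j, ∑ i, t j i * σ i ≤ p j * e j)
    (hbest : ∀ s : ι → κ, clusterValue q σ s ≤ ∑ j, p j * negCrossEntropy (e j) (e j)) :
    ∃ s : ι → κ, IsMaxClustering q σ s ∧ p = clusterMass q s ∧ e = clusterMean q σ s := by
  classical
  -- A center at 0 can only receive points at 0, so every pair used by the transport is admissible.
  have hadm : ∀ j i, 0 < t j i → e j = 0 → σ i = 0 := fun j i hpos h => by
    have h2 := hmean j
    rw [h, mul_zero] at h2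
    have h3 := single_le_sum (f := fun i => t j i * σ i)
      (fun i _ => mul_nonneg (ht j i) (h0 i)) (mem_univ i)
    have : t j i * σ i = 0 := le_antisymm (h3.trans h2) (mul_nonneg (ht j i) (h0 i))
    exact (mul_eq_zero.1 this).resolve_left hpos.ne'
  -- Send each point to its best admissible center; one exists because `q i > 0` forces some `t j i
  -- > 0`.
  have hex : ∀ i, ∃ j, (e j = 0 → σ i = 0) ∧ ∀ l, (e l = 0 → σ i = 0) →
      negCrossEntropy (e l) (σ i) ≤ negCrossEntropy (e j) (σ i) := fun i => by
    have hne : (univ.filter fun j => e j = 0 → σ i = 0).Nonempty := by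
      obtain ⟨j, -, hj⟩ := exists_lt_of_sum_lt (s := univ) (f := fun _ => 0)
        (g := fun j => t j i) (by simpa [hcol] using hq i)
      exact ⟨j, by simpa using hadm j i hj⟩
    obtain ⟨j, hj, hmax⟩ := exists_max_image _ (fun j => negCrossEntropy (e j) (σ i)) hne
    exact ⟨j, (mem_filter.1 hj).2, fun l hl => hmax l (by simpa using hl)⟩
  choose s hs hsmax using hex
  have hterm : ∀ j i, t j i * negCrossEntropy (e j) (σ i)
      ≤ t j i * negCrossEntropy (e (s i)) (σ i) := fun j i => by
    rcases (ht j i).eq_or_lt with h | h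
    · simp [← h]
    · exact mul_le_mul_of_nonneg_left (hsmax i j (hadm j i h)) h.le
  -- The true barycenter is at most `e j` and the tangent slope is nonpositive, so evaluating there
  -- instead of at `e j` does not lower the value.
  have hA : ∑ j, p j * negCrossEntropy (e j) (e j)
      ≤ ∑ j, ∑ i, t j i * negCrossEntropy (e j) (σ i) := sum_le_sum fun j _ => by
    have h2 : ∑ i, t j i * negCrossEntropy (e j) (σ i)
        = (∑ i, t j i * σ i) * (Real.log (e j) - Real.log (1 - e j))
          + p j * Real.log (1 - e j) := by
      rw [← hp, sum_mul, sum_mul, ← sum_add_distrib]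
      exact sum_congr rfl fun i _ => by rw [negCrossEntropy]; ring
    have h3 := mul_le_mul_of_nonpos_right (hmean j)
      (log_sub_log_one_sub_nonpos (he0 j) (he1 j))
    rw [h2, negCrossEntropy]
    linarith
  have hB : ∑ j, ∑ i, t j i * negCrossEntropy (e (s i)) (σ i)
      = ∑ i, q i * negCrossEntropy (e (s i)) (σ i) := by
    rw [sum_comm]
    exact sum_congr rfl fun i _ => by rw [← sum_mul, hcol]
  have hAB : ∑ j, ∑ i, t j i * negCrossEntropy (e j) (σ i)
      ≤ ∑ j, ∑ i, t j i * negCrossEntropy (e (s i)) (σ i) :=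
    sum_le_sum fun j _ => sum_le_sum fun i _ => hterm j i
  have hC := sum_negCrossEntropy_le_clusterValue hq h0 h1 he0 he1 hs
  have hmax : IsMaxClustering q σ s := fun s' => by linarith [hbest s']
  have hsurj := IsMaxClustering.surjective hq h0 h1 hσ hcard hmax
  have hemean : e = clusterMean q σ s := funext fun j => by
    obtain ⟨i, rfl⟩ := hsurj j
    exact eq_clusterMean_of_clusterValue_le hq h0 h1 he0 he1 hs (by linarith [hbest s]) i
  have heq : ∀ j i, t j i * negCrossEntropy (e j) (σ i)
      = t j i * negCrossEntropy (e (s i)) (σ i) := fun j i => by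
    have h2 := le_antisymm hAB (by linarith [hbest s])
    rw [sum_eq_sum_iff_of_le fun j _ => sum_le_sum fun i _ => hterm j i] at h2
    have h3 := h2 j (mem_univ j)
    rw [sum_eq_sum_iff_of_le fun i _ => hterm j i] at h3
    exact h3 i (mem_univ i)
  -- Positive transport to a second center would be a tie, which strict preference forbids.
  have hzero : ∀ j i, j ≠ s i → t j i = 0 := fun j i hj => by
    by_contra hne
    have hlt := IsMaxClustering.negCrossEntropy_lt hq h0 h1 hσ hcard hmax hj
      (by rw [← hemean]; exact hadm j i (lt_of_le_of_ne (ht j i) (Ne.symm hne)))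
    rw [← hemean] at hlt
    exact hlt.ne (mul_left_cancel₀ hne (heq j i))
  refine ⟨s, hmax, funext fun j => ?_, hemean⟩
  rw [← hp j, clusterMass, sum_filter]
  refine sum_congr rfl fun i _ => ?_
  split_ifs with h
  · rw [← hcol i, sum_eq_single j (fun l _ hl => hzero l i (h ▸ hl)) (by simp)]
  · exact hzero j i (Ne.symm h)

end Clustering

/-! ### Composition of channels. -/

namespace Channel

section Composition

variable {A X Y Z : Type*}

theorem prob_le_one (K : Channel X Y) (x : X) (y : Y) : K.prob x y ≤ 1 :=
  le_hasSum (K.hasSum_one x) y fun y' _ => K.nonneg x y'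

theorem summable_mul_prob (K : Channel X Y) {f : X → ℝ} (hf : ∀ x, 0 ≤ f x) (hs : Summable f)
    (y : Y) : Summable fun x => f x * K.prob x y :=
  hs.of_nonneg_of_le (fun x => mul_nonneg (hf x) (K.nonneg x y))
    fun x => mul_le_of_le_one_right (hf x) (K.prob_le_one x y)

theorem hasSum_prod_mul_prob (K : Channel X Y) {f : X → ℝ} {a : ℝ} (hf : ∀ x, 0 ≤ f x)
    (hs : HasSum f a) : HasSum (fun z : X × Y => f z.1 * K.prob z.1 z.2) a := by
  have h1 : ∀ x, HasSum (fun y => f x * K.prob x y) (f x) := fun x => by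
    simpa using (K.hasSum_one x).mul_left (f x)
  have h2 : Summable fun z : X × Y => f z.1 * K.prob z.1 z.2 := by
    refine (summable_prod_of_nonneg fun z => mul_nonneg (hf z.1) (K.nonneg z.1 z.2)).2
      ⟨fun x => (h1 x).summable, ?_⟩
    simpa only [(h1 _).tsum_eq] using hs.summable
  have h3 := h2.hasSum
  rw [h2.tsum_prod' fun x => (h1 x).summable] at h3
  simpa only [(h1 _).tsum_eq, hs.tsum_eq] using h3

theorem hasSum_tsum_mul_prob (K : Channel X Y) {f : X → ℝ} {a : ℝ} (hf : ∀ x, 0 ≤ f x)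
    (hs : HasSum f a) : HasSum (fun y => ∑' x, f x * K.prob x y) a := by
  have h := (Equiv.prodComm Y X).hasSum_iff.2 (K.hasSum_prod_mul_prob hf hs)
  exact h.prod_fiberwise fun y => (K.summable_mul_prob hf hs.summable y).hasSum

/-- The concatenation of two channels. -/
noncomputable def comp (K : Channel X Y) (R : Channel Y Z) : Channel X Z where
  prob x z := ∑' y, K.prob x y * R.prob y z
  nonneg x z := tsum_nonneg fun y => mul_nonneg (K.nonneg x y) (R.nonneg y z)
  hasSum_one x := R.hasSum_tsum_mul_prob (K.nonneg x) (K.hasSum_one x)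

theorem tsum_mul_comp (K : Channel X Y) (R : Channel Y Z) {f : X → ℝ} (hf : ∀ x, 0 ≤ f x)
    (hs : Summable f) (z : Z) :
    ∑' x, f x * (K.comp R).prob x z = ∑' y, (∑' x, f x * K.prob x y) * R.prob y z := by
  have h1 : Summable fun p : X × Y => f p.1 * (K.prob p.1 p.2 * R.prob p.2 z) := by
    refine (K.hasSum_prod_mul_prob hf hs.hasSum).summable.of_nonneg_of_le
      (fun p => mul_nonneg (hf _) (mul_nonneg (K.nonneg _ _) (R.nonneg _ _))) fun p => ?_
    exact mul_le_mul_of_nonneg_left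
      (mul_le_of_le_one_right (K.nonneg _ _) (R.prob_le_one _ _)) (hf _)
  calc ∑' x, f x * (K.comp R).prob x z
      = ∑' x, ∑' y, f x * (K.prob x y * R.prob y z) :=
        tsum_congr fun x => tsum_mul_left.symm
    _ = ∑' y, ∑' x, f x * (K.prob x y * R.prob y z) :=
        Summable.tsum_comm (f := fun y x => f x * (K.prob x y * R.prob y z))
          ((Equiv.prodComm Y X).summable_iff.2 h1)
    _ = _ := tsum_congr fun y => by
        rw [← tsum_mul_right]
        exact tsum_congr fun x => (mul_assoc _ _ _).symm

theorem IsDegradationOf.trans {U : BIDMC X} {V : BIDMC Y} {W : BIDMC Z}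
    (h : W.IsDegradationOf V) (h' : V.IsDegradationOf U) : W.IsDegradationOf U := by
  obtain ⟨R, hR⟩ := h
  obtain ⟨K, hK⟩ := h'
  refine ⟨K.comp R, fun a z => ?_⟩
  rw [hR, K.tsum_mul_comp R (U.nonneg a) (U.hasSum_one a).summable]
  simp_rw [hK]

end Composition

/-! ### Posterior probabilities, equivalence and transport. -/

section Posterior

variable {Y Z : Type*}

/-- The posterior probability of the input `0`. -/
noncomputable def posterior (W : BIDMC Y) (y : Y) : ℝ :=
  W.prob 0 y / (W.prob 0 y + W.prob 1 y)

variable (W : BIDMC Y)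

theorem outputProb_nonneg (y : Y) : 0 ≤ W.outputProb y :=
  div_nonneg (add_nonneg (W.nonneg 0 y) (W.nonneg 1 y)) zero_le_two

theorem hasSum_outputProb : HasSum W.outputProb 1 := by
  have h := ((W.hasSum_one 0).add (W.hasSum_one 1)).div_const 2
  rwa [show ((1 : ℝ) + 1) / 2 = 1 by norm_num] at h

theorem prob_eq_zero {y : Y} (h : W.outputProb y = 0) (a : Fin 2) : W.prob a y = 0 := by
  have h0 := W.nonneg 0 y
  have h1 := W.nonneg 1 y
  unfold outputProb at h
  fin_cases a
  · change W.prob 0 y = 0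
    linarith
  · change W.prob 1 y = 0
    linarith

theorem posterior_mem_Icc (y : Y) : W.posterior y ∈ Set.Icc (0 : ℝ) 1 := by
  have h0 := W.nonneg 0 y
  have h1 := W.nonneg 1 y
  exact ⟨div_nonneg h0 (add_nonneg h0 h1),
    div_le_one_of_le₀ (by linarith) (add_nonneg h0 h1)⟩

theorem prob_zero_eq (y : Y) : W.prob 0 y = 2 * W.posterior y * W.outputProb y := by
  by_cases h : W.outputProb y = 0
  · rw [W.prob_eq_zero h, h, mul_zero]
  · have : W.prob 0 y + W.prob 1 y ≠ 0 := fun h' => h (by rw [outputProb, h', zero_div])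
    unfold posterior outputProb
    field_simp

theorem prob_one_eq (y : Y) : W.prob 1 y = 2 * (1 - W.posterior y) * W.outputProb y := by
  have h := W.prob_zero_eq y
  have h2 : W.prob 0 y + W.prob 1 y = 2 * W.outputProb y := by unfold outputProb; ring
  linarith

open Classical in
theorem indicator_lrLevel (e : ℝ) (y : Y) :
    (W.lrLevel e).indicator W.outputProb y = if W.posterior y = e then W.outputProb y else 0 := by
  by_cases h : W.outputProb y = 0
  · simp [Set.indicator_apply, h]
  · have : y ∈ W.lrLevel e ↔ W.posterior y = e := by
      rw [lrLevel, Set.mem_ofPred_eq, prob_zero_eq, prob_one_eq]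
      constructor
      · intro h'
        refine mul_left_cancel₀ h ?_
        linarith
      · rintro rfl
        ring
    simp [Set.indicator_apply, this]

open Classical in
theorem lrProfile_eq_tsum (e : ℝ) :
    W.lrProfile e = ∑' y, if W.posterior y = e then W.outputProb y else 0 :=
  tsum_congr fun y => W.indicator_lrLevel e y

open Classical in
theorem hasSum_lrProfile (e : ℝ) :
    HasSum (fun y => if W.posterior y = e then W.outputProb y else 0) (W.lrProfile e) := by
  rw [lrProfile_eq_tsum]
  refine (W.hasSum_outputProb.summable.of_nonneg_of_le (fun y => ?_) fun y => ?_).hasSum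
  · split_ifs
    exacts [W.outputProb_nonneg y, le_rfl]
  · split_ifs
    exacts [le_rfl, W.outputProb_nonneg y]

theorem outputProb_le_lrProfile (y : Y) : W.outputProb y ≤ W.lrProfile (W.posterior y) := by
  classical
  have := le_hasSum (W.hasSum_lrProfile (W.posterior y)) y fun y' _ => by
    split_ifs
    exacts [W.outputProb_nonneg y', le_rfl]
  simpa using this

variable {W} {V : BIDMC Z}

/-- A channel is a degradation of each channel equivalent to it, through an intermediate channel
that preserves the posterior probabilities. -/
theorem Equivalent.exists_channel (h : W.Equivalent V) :
    ∃ K : Channel Y Z, (∀ a z, V.prob a z = ∑' y, W.prob a y * K.prob y z) ∧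
      ∀ y z, W.prob 0 y * K.prob y z = 2 * V.posterior z * W.outputProb y * K.prob y z := by
  classical
  have hVpos : ∀ z, 0 ≤ V.lrProfile (V.posterior z) := fun z =>
    (V.outputProb_nonneg z).trans (V.outputProb_le_lrProfile z)
  -- Given `y`, draw `z` from the outputs of `V` with the same posterior, in proportion to their
  -- probabilities. Null outputs `y` get an arbitrary distribution.
  let K : Channel Y Z :=
    { prob := fun y z => if W.outputProb y = 0 then V.outputProb z else
        if V.posterior z = W.posterior y then V.outputProb z / V.lrProfile (V.posterior z) else 0
      nonneg := fun y z => by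
        split_ifs
        exacts [V.outputProb_nonneg z, div_nonneg (V.outputProb_nonneg z) (hVpos z), le_rfl]
      hasSum_one := fun y => by
        by_cases hy : W.outputProb y = 0
        · simpa [hy] using V.hasSum_outputProb
        · simp only [hy, if_false]
          have h1 := (V.hasSum_lrProfile (W.posterior y)).div_const
            (V.lrProfile (W.posterior y))
          have h2 : V.lrProfile (W.posterior y) ≠ 0 := by
            rw [← h _ (W.posterior_mem_Icc y)]
            exact ((lt_of_le_of_ne (W.outputProb_nonneg y) (Ne.symm hy)).trans_le
              (W.outputProb_le_lrProfile y)).ne'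
          rw [div_self h2] at h1
          refine h1.congr_fun fun z => ?_
          split_ifs with hz
          · rw [hz]
          · rw [zero_div] }
  have hK : ∀ y z, W.outputProb y * K.prob y z
      = (if W.posterior y = V.posterior z then W.outputProb y else 0)
        * (V.outputProb z / V.lrProfile (V.posterior z)) := fun y z => by
    by_cases hy : W.outputProb y = 0
    · simp [hy]
    · by_cases hz : V.posterior z = W.posterior y
      · simp [K, hy, hz]
      · simp [K, hy, hz, Ne.symm hz]
  have hK0 : ∀ y z, W.prob 0 y * K.prob y z
      = 2 * V.posterior z * (W.outputProb y * K.prob y z) := fun y z => by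
    rw [prob_zero_eq, mul_assoc, hK]
    split_ifs with hz
    · rw [hz]
    · simp
  have hK1 : ∀ y z, W.prob 1 y * K.prob y z
      = 2 * (1 - V.posterior z) * (W.outputProb y * K.prob y z) := fun y z => by
    rw [prob_one_eq, mul_assoc, hK]
    split_ifs with hz
    · rw [hz]
    · simp
  have hsum : ∀ z, ∑' y, W.outputProb y * K.prob y z = V.outputProb z := fun z => by
    simp_rw [hK]
    rw [tsum_mul_right, ← lrProfile_eq_tsum, h _ (V.posterior_mem_Icc z)]
    by_cases hz : V.lrProfile (V.posterior z) = 0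
    · rw [hz, zero_mul]
      exact le_antisymm (V.outputProb_nonneg z) ((V.outputProb_le_lrProfile z).trans hz.le)
    · exact mul_div_cancel₀ _ hz
  refine ⟨K, fun a z => ?_, fun y z => by rw [hK0, mul_assoc (2 * _)]⟩
  fin_cases a
  · change V.prob 0 z = ∑' y, W.prob 0 y * K.prob y z
    simp_rw [hK0]
    rw [tsum_mul_left, hsum, prob_zero_eq]
  · change V.prob 1 z = ∑' y, W.prob 1 y * K.prob y z
    simp_rw [hK1]
    rw [tsum_mul_left, hsum, prob_one_eq]

theorem tsum_outputProb_mul_prob (K : Channel Y Z)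
    (h : ∀ a z, V.prob a z = ∑' y, W.prob a y * K.prob y z) (z : Z) :
    ∑' y, W.outputProb y * K.prob y z = V.outputProb z := by
  have h0 := (K.summable_mul_prob (W.nonneg 0) (W.hasSum_one 0).summable z).hasSum
  have h1 := (K.summable_mul_prob (W.nonneg 1) (W.hasSum_one 1).summable z).hasSum
  rw [← h] at h0 h1
  rw [outputProb, ← ((h0.add h1).div_const 2).tsum_eq]
  exact tsum_congr fun y => by rw [outputProb]; ring

variable [Fintype Z]

theorem sum_prob (K : Channel Y Z) (y : Y) : ∑ z, K.prob y z = 1 :=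
  (hasSum_fintype _).unique (K.hasSum_one y)

/-- A channel that is equivalent to one with a finite output alphabet has the same posterior
probabilities. -/
theorem Equivalent.posterior_mem_image (h : W.Equivalent V) {y : Y} (hy : W.outputProb y ≠ 0) :
    W.posterior y ∈ Set.range V.posterior := by
  classical
  -- The finitely many posteriors of `V` already carry all the mass of the common profile, leaving
  -- none for other values.
  have h1 : ∑ e ∈ univ.image V.posterior, V.lrProfile e = 1 := by
    simp_rw [lrProfile_eq_tsum, tsum_fintype]
    rw [sum_comm, ← V.hasSum_outputProb.tsum_eq, tsum_fintype]
    refine sum_congr rfl fun z _ => ?_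
    rw [sum_ite_eq, if_pos (mem_image_of_mem _ (mem_univ z))]
  have h2 := hasSum_sum (s := univ.image V.posterior) fun e _ => W.hasSum_lrProfile e
  rw [sum_congr rfl (g := V.lrProfile) fun e he => by
    obtain ⟨z, -, rfl⟩ := mem_image.1 he
    exact h _ (V.posterior_mem_Icc z), h1] at h2
  simp_rw [sum_ite_eq] at h2
  have h3 := W.hasSum_outputProb.sub h2
  rw [sub_self, hasSum_zero_iff_of_nonneg fun y => by
    split_ifs
    · simp
    · simpa using W.outputProb_nonneg y] at h3
  have h4 := congrFun h3 y
  by_contra hn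
  rw [if_neg (by simpa using hn)] at h4
  exact hy (by simpa using h4)

/-- If `W` is a degradation of `Q`, then the outputs of `U ≅ Q` can be transported to the outputs
of `V ≅ W` in a way that preserves the mean of the posterior probability. -/
theorem IsDegradationOf.exists_transport {X I : Type*} [Fintype I] {Q : BIDMC X} {U : BIDMC I}
    (h : W.IsDegradationOf Q) (hW : W.Equivalent V) (hQ : Q.Equivalent U) :
    ∃ T : I → Z → ℝ, (∀ i z, 0 ≤ T i z) ∧ (∀ i, ∑ z, T i z = U.outputProb i) ∧
      (∀ z, ∑ i, T i z = V.outputProb z) ∧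
      ∀ z, ∑ i, U.posterior i * T i z = V.prob 0 z / 2 := by
  obtain ⟨R, hR, hR'⟩ := hQ.exists_channel
  obtain ⟨R', hR'', -⟩ := hW.exists_channel
  obtain ⟨K, hK⟩ := IsDegradationOf.trans (W := V) ⟨R', hR''⟩ h
  have hsR : ∀ i, Summable fun x => Q.outputProb x * R.prob x i :=
    R.summable_mul_prob Q.outputProb_nonneg Q.hasSum_outputProb.summable
  have hs : ∀ i z, Summable fun x => Q.outputProb x * R.prob x i * K.prob x z := fun i =>
    K.summable_mul_prob (fun x => mul_nonneg (Q.outputProb_nonneg x) (R.nonneg x i)) (hsR i)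
  -- Couple the outputs of `U` and `V` by drawing them independently given the output `x` of `Q`.
  -- Means are preserved because `R` preserves posteriors.
  refine ⟨fun i z => ∑' x, Q.outputProb x * R.prob x i * K.prob x z,
    fun i z => tsum_nonneg fun x =>
      mul_nonneg (mul_nonneg (Q.outputProb_nonneg x) (R.nonneg x i)) (K.nonneg x z),
    fun i => ?_, fun z => ?_, fun z => ?_⟩
  · rw [← Summable.tsum_finsetSum fun z _ => hs i z, ← tsum_outputProb_mul_prob R hR]
    simp_rw [← mul_sum, K.sum_prob, mul_one]
  · rw [← Summable.tsum_finsetSum fun i _ => hs i z, ← tsum_outputProb_mul_prob K hK]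
    simp_rw [← sum_mul, ← mul_sum, R.sum_prob, mul_one]
  · simp_rw [← tsum_mul_left]
    rw [← Summable.tsum_finsetSum fun i _ => (hs i z).mul_left _, hK, ← tsum_div_const]
    refine tsum_congr fun x => ?_
    rw [← mul_one (Q.prob 0 x), ← R.sum_prob x, mul_sum, sum_mul, sum_div]
    refine sum_congr rfl fun i _ => ?_
    rw [hR']
    ring

theorem symmCapacity_eq_tsum (W : BIDMC Y) :
    W.symmCapacity = ∑' y, (W.posterior y * Real.logb 2 (2 * W.posterior y)
      + (1 - W.posterior y) * Real.logb 2 (2 * (1 - W.posterior y))) * W.outputProb y := by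
  refine tsum_congr fun y => ?_
  rw [Fin.sum_univ_two]
  by_cases h : W.outputProb y = 0
  · simp [h, W.prob_eq_zero h]
  · have h2 : 1 / 2 * W.prob 0 y + 1 / 2 * W.prob 1 y = W.outputProb y := by
      unfold outputProb
      ring
    rw [h2, prob_zero_eq, prob_one_eq, mul_div_cancel_right₀ _ h, mul_div_cancel_right₀ _ h]
    ring

/-- Sorting outputs by posterior shows that such an expectation depends only on the LR-profile; this
makes capacity an invariant of equivalence. -/
theorem Equivalent.tsum_posterior (h : W.Equivalent V) (H : ℝ → ℝ) [DecidableEq ℝ] :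
    ∑' y, H (W.posterior y) * W.outputProb y
      = ∑ e ∈ univ.image V.posterior, H e * V.lrProfile e := by
  have h2 := hasSum_sum (s := univ.image V.posterior)
    fun e _ => (W.hasSum_lrProfile e).mul_left (H e)
  rw [sum_congr rfl (g := fun e => H e * V.lrProfile e) fun e he => by
    obtain ⟨z, -, rfl⟩ := mem_image.1 he
    rw [h _ (V.posterior_mem_Icc z)]] at h2
  rw [← h2.tsum_eq]
  refine tsum_congr fun y => ?_
  by_cases hy : W.outputProb y = 0
  · simp [hy]
  · have h3 := h.posterior_mem_image hy
    rw [sum_eq_single (W.posterior y)]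
    · simp
    · intro e _ he
      simp [Ne.symm he]
    · intro hn
      exact absurd (by simpa using h3) hn

theorem Equivalent.symmCapacity_eq (h : W.Equivalent V) : W.symmCapacity = V.symmCapacity := by
  classical
  have hV : V.Equivalent V := fun _ _ => rfl
  rw [symmCapacity_eq_tsum, symmCapacity_eq_tsum,
    h.tsum_posterior fun e => e * Real.logb 2 (2 * e) + (1 - e) * Real.logb 2 (2 * (1 - e)),
    hV.tsum_posterior fun e => e * Real.logb 2 (2 * e) + (1 - e) * Real.logb 2 (2 * (1 - e))]

end Posterior

/-! ### Mixtures of binary symmetric channels. -/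

section Mixture

variable {n : ℕ} (p : stdSimplex ℝ (Fin n)) (ε : Fin n → Set.Icc (0 : ℝ) 1)

theorem bscMix_prob (a : Fin 2) (j : Fin n) (b : Fin 2) :
    (bscMix p ε).prob a (j, b) = p.1 j * if a = b then 1 - (ε j : ℝ) else ε j := rfl

theorem bscMix_outputProb (z : Fin n × Fin 2) : (bscMix p ε).outputProb z = p.1 z.1 / 2 := by
  obtain ⟨j, b⟩ := z
  simp only [outputProb, bscMix_prob]
  fin_cases b <;> simp <;> ring

theorem bscMix_posterior {j : Fin n} (hj : p.1 j ≠ 0) (b : Fin 2) :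
    (bscMix p ε).posterior (j, b) = if 0 = b then 1 - (ε j : ℝ) else ε j := by
  have h : (bscMix p ε).prob 0 (j, b) + (bscMix p ε).prob 1 (j, b) = p.1 j := by
    have := bscMix_outputProb p ε (j, b)
    rw [outputProb] at this
    linarith
  rw [posterior, h, bscMix_prob, mul_div_cancel_left₀ _ hj]

open Classical in
theorem bscMix_lrProfile (e : ℝ) : (bscMix p ε).lrProfile e = ∑ j,
    ((if (1 - e) * (p.1 j * (1 - (ε j : ℝ))) = e * (p.1 j * ε j) then p.1 j / 2 else 0)
      + if (1 - e) * (p.1 j * ε j) = e * (p.1 j * (1 - (ε j : ℝ))) then p.1 j / 2 else 0) := by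
  rw [lrProfile, tsum_fintype, Fintype.sum_prod_type]
  refine sum_congr rfl fun j _ => ?_
  rw [Fin.sum_univ_two]
  simp [Set.indicator_apply, bscMix_outputProb, lrLevel, bscMix_prob]

/-- A mixture does not change if the sub-channels are permuted and the outputs of some of them are
exchanged. -/
theorem bscMix_equivalent {p p' : stdSimplex ℝ (Fin n)} {ε ε' : Fin n → Set.Icc (0 : ℝ) 1}
    (π : Equiv.Perm (Fin n)) (hp : ∀ j, p'.1 j = p.1 (π j))
    (hε : ∀ j, (ε' j : ℝ) = ε (π j) ∨ (ε' j : ℝ) = 1 - ε (π j)) :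
    (bscMix p ε).Equivalent (bscMix p' ε') := by
  intro e _
  rw [bscMix_lrProfile, bscMix_lrProfile, ← Equiv.sum_comp π]
  refine sum_congr rfl fun j _ => ?_
  rw [hp]
  rcases hε j with h | h
  · rw [h]
  · rw [h, add_comm, sub_sub_cancel]

theorem bscMix_symmCapacity : (bscMix p ε).symmCapacity
    = 1 + (∑ j, p.1 j * negCrossEntropy (ε j) (ε j)) / Real.log 2 := by
  have hlog : Real.log 2 ≠ 0 := (Real.log_pos one_lt_two).ne'
  have key : ∀ x : ℝ, x * Real.logb 2 (2 * x) = x + x * Real.log x / Real.log 2 := fun x => by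
    by_cases hx : x = 0
    · simp [hx]
    · rw [Real.logb, Real.log_mul two_ne_zero hx]
      field_simp
  have hp : ∑ j, p.1 j = 1 := p.2.2
  rw [symmCapacity_eq_tsum, tsum_fintype, Fintype.sum_prod_type, sum_div]
  -- The constant 1 is spread out as Σ p_j, so that the identity holds term by term.
  refine Eq.trans ?_ (congrArg (· + _) hp)
  rw [← sum_add_distrib]
  refine sum_congr rfl fun j _ => ?_
  rw [Fin.sum_univ_two]
  by_cases hj : p.1 j = 0
  · simp [bscMix_outputProb, hj]
  · simp only [bscMix_posterior p ε hj, bscMix_outputProb, key, negCrossEntropy]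
    simp
    ring

end Mixture

end Channel

/-- The posteriors of the particle `i` are `σ i` and `1 - σ i`, both at least `σ i`. Forgetting the
output bits thus turns the mean identity into an inequality, for either choice of input and hence
for the minimum. -/
theorem Channel.IsDegradationOf.exists_folded_transport {m n : ℕ} {X Y : Type*} {Q : BIDMC X}
    {W : BIDMC Y} {q : stdSimplex ℝ (Fin m)} {σ : Fin m → Set.Icc (0 : ℝ) 1}
    {p : stdSimplex ℝ (Fin n)} {ε : Fin n → Set.Icc (0 : ℝ) 1} (h : W.IsDegradationOf Q)
    (hW : W.Equivalent (bscMix p ε)) (hQ : Q.Equivalent (bscMix q σ)) (hq : ∀ i, 0 < q.1 i)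
    (hσ : ∀ i, (σ i : ℝ) ≤ 1 / 2) :
    ∃ t : Fin n → Fin m → ℝ, (∀ j i, 0 ≤ t j i) ∧ (∀ j, ∑ i, t j i = p.1 j) ∧
      (∀ i, ∑ j, t j i = q.1 i) ∧
      ∀ j, ∑ i, t j i * σ i ≤ p.1 j * min (ε j : ℝ) (1 - ε j) := by
  obtain ⟨T, hT, hrow, hcol, hmean⟩ := h.exists_transport hW hQ
  have hle0 : ∀ z, ∑ i, T i z * σ i.1 ≤ (bscMix p ε).prob 0 z / 2 := fun z => by
    rw [← hmean]
    refine sum_le_sum fun i _ => ?_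
    rw [mul_comm]
    refine mul_le_mul_of_nonneg_right ?_ (hT i z)
    rw [show i = (i.1, i.2) from rfl, bscMix_posterior _ _ (hq i.1).ne']
    split_ifs
    · linarith [hσ i.1]
    · exact le_rfl
  have hle1 : ∀ z, ∑ i, T i z * σ i.1 ≤ (bscMix p ε).prob 1 z / 2 := fun z => by
    have h2 : (bscMix p ε).prob 1 z / 2 = (bscMix p ε).outputProb z - (bscMix p ε).prob 0 z / 2 := by
      unfold outputProb
      ring
    rw [h2, ← hmean, ← hcol, ← sum_sub_distrib]
    refine sum_le_sum fun i _ => ?_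
    rw [show T i z - (bscMix q σ).posterior i * T i z
      = (1 - (bscMix q σ).posterior i) * T i z by ring, mul_comm]
    refine mul_le_mul_of_nonneg_right ?_ (hT i z)
    rw [show i = (i.1, i.2) from rfl, bscMix_posterior _ _ (hq i.1).ne']
    split_ifs
    · linarith
    · linarith [hσ i.1]
  refine ⟨fun j i => ∑ b', ∑ b, T (i, b) (j, b'),
    fun j i => sum_nonneg fun b' _ => sum_nonneg fun b _ => hT _ _, fun j => ?_, fun i => ?_,
    fun j => ?_⟩
  · rw [sum_comm]
    have h2 : ∀ b', ∑ i, ∑ b, T (i, b) (j, b') = p.1 j / 2 := fun b' => by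
      rw [← Fintype.sum_prod_type fun z => T z (j, b'), hcol, bscMix_outputProb]
    simp_rw [h2]
    rw [Fin.sum_univ_two, add_halves]
  · rw [sum_congr rfl fun j _ => sum_comm, sum_comm]
    have h2 : ∀ b, ∑ j, ∑ b', T (i, b) (j, b') = q.1 i / 2 := fun b => by
      rw [← Fintype.sum_prod_type fun z => T (i, b) z, hrow, bscMix_outputProb]
    simp_rw [h2]
    rw [Fin.sum_univ_two, add_halves]
  · simp_rw [sum_mul]
    rw [sum_comm]
    have h2 : ∀ b', ∑ i, ∑ b, T (i, b) (j, b') * (σ i : ℝ)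
        ≤ p.1 j * min (ε j : ℝ) (1 - ε j) / 2 := fun b' => by
      have a0 := hle0 (j, b')
      have a1 := hle1 (j, b')
      rw [Fintype.sum_prod_type, bscMix_prob] at a0 a1
      rcases min_cases (ε j : ℝ) (1 - ε j) with ⟨h3, -⟩ | ⟨h3, -⟩ <;> rw [h3] <;>
        fin_cases b' <;> simp at a0 a1 ⊢ <;> assumption
    calc _ ≤ ∑ _b' : Fin 2, p.1 j * min (ε j : ℝ) (1 - ε j) / 2 := sum_le_sum fun b' _ => h2 b'
      _ = _ := by rw [Fin.sum_univ_two, add_halves]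

/-! ### Monotone clusterings as intervals, and as P*-degradations. -/

theorem nth_succ {m : ℕ} (x : Fin m → ℝ) (i : Fin m) : nth x (i + 1) = x i := by
  rw [nth, dif_pos ⟨by omega, by omega⟩]
  rfl

theorem nth_mul {m : ℕ} (x y : Fin m → ℝ) (a : ℕ) :
    nth (fun i => x i * y i) a = nth x a * nth y a := by
  unfold nth
  split_ifs <;> simp

section Boundaries

variable {m n : ℕ}

/-- The first element (counted from `1`) of the `j`-th fibre of a monotone surjection. -/
def clusterStart (g : Fin m → Fin n) (j : ℕ) : ℕ :=
  #{i | (g i : ℕ) < j} + 1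

variable {g : Fin m → Fin n} (hg : Monotone g)

include hg in
-- By monotonicity the points with label below `j` form an initial segment, so counting them locates
-- its end.
theorem clusterStart_le_iff {i : Fin m} {j : ℕ} : clusterStart g j ≤ i + 1 ↔ j ≤ g i := by
  unfold clusterStart
  rw [add_le_add_iff_right]
  constructor
  · intro h
    by_contra! hlt
    have : Iic i ⊆ ({i | (g i : ℕ) < j} : Finset (Fin m)) := fun l hl => by
      have := Fin.le_def.1 (hg (mem_Iic.1 hl))
      simp only [mem_filter, mem_univ, true_and]
      omega
    have := card_le_card this
    rw [Fin.card_Iic] at this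
    omega
  · intro h
    have : ({i | (g i : ℕ) < j} : Finset (Fin m)) ⊆ Iio i := fun l hl => by
      rw [mem_Iio]
      by_contra! hle
      have := Fin.le_def.1 (hg hle)
      simp only [mem_filter, mem_univ, true_and] at hl
      omega
    simpa using card_le_card this

theorem clusterStart_zero : clusterStart g 0 = 1 := by
  simp [clusterStart]

theorem clusterStart_last : clusterStart g n = m + 1 := by
  simp [clusterStart]

theorem one_le_clusterStart (j : ℕ) : 1 ≤ clusterStart g j :=
  Nat.le_add_left _ _

theorem clusterStart_le (j : ℕ) : clusterStart g j ≤ m + 1 := by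
  unfold clusterStart
  simpa using card_le_univ ({i | (g i : ℕ) < j} : Finset (Fin m))

include hg in
theorem clusterStart_lt_succ (hsurj : Function.Surjective g) (j : Fin n) :
    clusterStart g j < clusterStart g (j + 1) := by
  obtain ⟨i, rfl⟩ := hsurj j
  have h1 := (clusterStart_le_iff hg (i := i) (j := g i)).2 le_rfl
  have h2 := (clusterStart_le_iff hg (i := i) (j := g i + 1)).not.2 (by omega)
  omega

include hg in
theorem sum_nth_clusterStart (w : Fin m → ℝ) (j : Fin n) :
    ∑ a ∈ Ico (clusterStart g j) (clusterStart g (j + 1)), nth w a = clusterMass w g j := by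
  have hmem : ∀ i : Fin m,
      (i : ℕ) + 1 ∈ Ico (clusterStart g j) (clusterStart g (j + 1)) ↔ g i = j := fun i => by
    rw [mem_Ico, ← not_le, clusterStart_le_iff hg, clusterStart_le_iff hg, Fin.ext_iff]
    omega
  symm
  refine sum_nbij (fun i => (i : ℕ) + 1) (fun i hi => (hmem i).2 (mem_filter.1 hi).2)
    (fun i _ i' _ h => Fin.ext (by simpa using h)) (fun a ha => ?_) fun i _ => (nth_succ w i).symm
  have h1 := one_le_clusterStart (g := g) j
  have h2 := clusterStart_le (g := g) (j + 1)
  have ha' := mem_Ico.1 (mem_coe.1 ha)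
  have h3 : (((⟨a - 1, by omega⟩ : Fin m) : ℕ) + 1) = a := by
    simp only
    omega
  refine ⟨⟨a - 1, by omega⟩, ?_, h3⟩
  have := (hmem ⟨a - 1, by omega⟩).1 (by rw [h3]; exact ha)
  simpa using this

end Boundaries

/-- Giving each boundary particle entirely to the upper side makes the closed segment half-open. -/
theorem sum_segmentWeight_mul (q f : ℕ → ℝ) {l l' : ℕ} (h : l < l') :
    ∑ a ∈ Icc l l', segmentWeight q l l' (q l) (q l') a * f a = ∑ a ∈ Ico l l', q a * f a := by
  rw [← Ico_insert_right h.le, sum_insert right_notMem_Ico]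
  have h1 : segmentWeight q l l' (q l) (q l') l' = 0 := by
    simp [segmentWeight, h.ne']
  rw [h1, zero_mul, zero_add]
  refine sum_congr rfl fun a ha => ?_
  have ha' := mem_Ico.1 ha
  congr 1
  unfold segmentWeight
  split_ifs with h2 h3 h4
  · rw [h2]
  · omega
  · rfl
  · omega

section

variable {m n : ℕ} {q σ : Fin m → ℝ} (hq : ∀ i, 0 < q i) (h0 : ∀ i, 0 ≤ σ i)
  (h1 : ∀ i, σ i ≤ 1 / 2) {g : Fin m → Fin n} (hg : Monotone g)

include h0 h1 in
theorem nth_mem_Icc_half (a : ℕ) : 0 ≤ nth σ a ∧ nth σ a ≤ 1 / 2 := by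
  unfold nth
  split_ifs
  · exact ⟨h0 _, h1 _⟩
  · norm_num

include hq in
theorem nth_pos {a : ℕ} (h : 1 ≤ a) (h' : a ≤ m) : 0 < nth q a := by
  rw [nth, dif_pos ⟨h, h'⟩]
  exact hq _

include hq in
theorem nth_nonneg (a : ℕ) : 0 ≤ nth q a := by
  unfold nth
  split_ifs
  exacts [(hq _).le, le_rfl]

include hq h0 h1 hg in
theorem isDPlus_clusterStart :
    IsDPlus q σ (fun j : Fin (n + 1) => clusterStart g j) (clusterMass q g)
      (clusterMean q σ g) := by
  intro j
  refine ⟨fun a _ => nth_mem_Icc_half h0 h1 a, ?_, ?_⟩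
  · exact (sum_nth_clusterStart hg q j).symm
  · rw [clusterMass_mul_clusterMean hq, ← sum_nth_clusterStart hg _ j]
    exact sum_congr rfl fun a _ => nth_mul q σ a

include hq h0 h1 hg in
theorem isPStarDegradation_of_monotone (hsurj : Function.Surjective g)
    (hmean : StrictMono (clusterMean q σ g)) (hn : 0 < n) :
    IsPStarDegradation q σ (clusterMass q g) (clusterMean q σ g) := by
  -- The first breakpoint must be 0 although the first cluster starts at 1; this is harmless since
  -- `nth` vanishes at 0.
  set i : Fin (n + 1) → ℕ := fun j => if j = 0 then 0 else clusterStart g j with hi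
  have hsucc : ∀ j : Fin n, i j.succ = clusterStart g (j + 1) := fun j => by
    simp [hi, Fin.succ_ne_zero]
  have hlt : ∀ j : Fin n, i j.castSucc < i j.succ := fun j => by
    rw [hsucc]
    by_cases hj : j.castSucc = 0
    · simp [hi, hj, clusterStart]
    · simpa [hi, hj] using clusterStart_lt_succ hg hsurj j
  have hcast : ∀ j : Fin n, i j.castSucc ≠ 0 → i j.castSucc = clusterStart g j := fun j hj => by
    by_cases h : j.castSucc = 0
    · simp [hi, h] at hj
    · simp [hi, h]
  have hadj : ∀ j : Fin n, i j.succ = i j.castSucc + 1 → i j.castSucc ≠ 0 := fun j hj h => by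
    have h2 := clusterStart_lt_succ hg hsurj j
    have h3 := one_le_clusterStart (g := g) j
    rw [h, hsucc] at hj
    omega
  have hsum : ∀ (w : Fin m → ℝ) (j : Fin n),
      ∑ a ∈ Ico (i j.castSucc) (i j.succ), nth w a = clusterMass w g j := fun w j => by
    rw [← sum_nth_clusterStart hg, hsucc]
    by_cases h : i j.castSucc = 0
    · have hj : (j : ℕ) = 0 := by
        by_contra hne
        have : j.castSucc ≠ 0 := fun h' => hne (by simpa using congrArg Fin.val h')
        simp [hi, this, clusterStart] at h
      rw [h, hj, clusterStart_zero, sum_eq_sum_Ico_succ_bot (by simp [clusterStart])]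
      simp [nth]
    · rw [hcast j h]
  refine ⟨i, fun j => nth q (i j), by simp [hi], ?_, Fin.strictMono_iff_lt_succ.2 hlt,
    by simp [hi, nth], ?_, fun j => ⟨nth_nonneg hq _, le_rfl⟩, fun j => ⟨fun a _ =>
      nth_mem_Icc_half h0 h1 a, ?_, ?_⟩, fun j => ?_, hmean, fun j hj => ?_⟩
  · have : Fin.last n ≠ 0 := by simp [Fin.ext_iff, hn.ne']
    simp [hi, this, clusterStart_last]
  · have : Fin.last n ≠ 0 := by simp [Fin.ext_iff, hn.ne']
    simp [hi, this, clusterStart_last, nth]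
  · have := sum_segmentWeight_mul (nth q) 1 (hlt j)
    simp only [Pi.one_apply, mul_one] at this
    rw [this, hsum]
  · rw [sum_segmentWeight_mul _ _ (hlt j), clusterMass_mul_clusterMean hq, ← hsum]
    exact sum_congr rfl fun a _ => nth_mul q σ a
  · obtain ⟨l, rfl⟩ := hsurj j
    exact clusterMass_pos hq l
  -- Adjacent breakpoints enclose a singleton cluster. Its full positive weight makes the first
  -- clause vacuous, and being a singleton gives the second.
  · have hne := hadj j hj
    have hle : i j.castSucc ≤ m := by
      have := clusterStart_le (g := g) (j + 1)
      rw [← hsucc] at this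
      have := hlt j
      omega
    have hpos := nth_pos hq (Nat.one_le_iff_ne_zero.2 hne) hle
    have hp : ∀ w : Fin m → ℝ, clusterMass w g j = nth w (i j.castSucc) := fun w => by
      rw [← hsum, hj]
      simp
    refine ⟨fun h => absurd h hpos.ne', fun _ => ⟨rfl, hp q, ?_⟩⟩
    rw [clusterMean, hp, hp, nth_mul, mul_div_cancel_left₀ _ hpos.ne']

end

/-! ### Sorting the clusters and the main theorem. -/

theorem IsMaxClustering.exists_perm {ι : Type*} [Fintype ι] {n : ℕ} {q σ : ι → ℝ}
    (hq : ∀ i, 0 < q i) (h0 : ∀ i, 0 ≤ σ i) (h1 : ∀ i, σ i ≤ 1 / 2)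
    (hσ : Function.Injective σ) {s : ι → Fin n} (hcard : n < Fintype.card ι)
    (hs : IsMaxClustering q σ s) :
    ∃ π : Equiv.Perm (Fin n), IsMaxClustering q σ (π.symm ∘ s) ∧
      StrictMono (clusterMean q σ (π.symm ∘ s)) := by
  refine ⟨Tuple.sort (clusterMean q σ s), fun s' => ?_, ?_⟩
  · rw [clusterValue_perm]
    exact hs s'
  · have h : clusterMean q σ ((Tuple.sort (clusterMean q σ s)).symm ∘ s)
        = clusterMean q σ s ∘ Tuple.sort (clusterMean q σ s) :=
      funext fun j => clusterMean_perm _ j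
    rw [h]
    exact (Tuple.monotone_sort _).strictMono_of_injective
      ((hs.clusterMean_injective hq h0 h1 hσ (by simpa using hcard)).comp (Equiv.injective _))

theorem theorem5 {m n : ℕ} (hn : 2 ≤ n) (hnm : n < m)
    (q : stdSimplex ℝ (Fin m)) (σ : Fin m → Set.Icc (0 : ℝ) 1)
    (hq : ∀ i, 0 < q.1 i) (hσ : StrictMono σ) (hσ' : ∀ i, (σ i : ℝ) ≤ 1 / 2)
    {X Y : Type*} (Q : BIDMC X) (hQ : Q.Equivalent (Channel.bscMix q σ))
    (W : BIDMC Y) (hW : IsCOptimal n q σ Q W) :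
    ∃ k : Fin (n + 1) → ℕ, k 0 = 1 ∧ k (Fin.last n) = m + 1 ∧ StrictMono k ∧
      ∃ (p : stdSimplex ℝ (Fin n)) (ε : Fin n → Set.Icc (0 : ℝ) 1),
        IsDPlus q.1 (fun i => (σ i : ℝ)) k p.1 (fun j => (ε j : ℝ)) ∧
        W.Equivalent (Channel.bscMix p ε) ∧
        ∀ (j : ℕ) (hj : j + 1 < n), 0 < (ε ⟨j, by omega⟩ : ℝ) →
          nth (fun i => (σ i : ℝ)) (k ⟨j + 1, by omega⟩ - 1)
              < phi (ε ⟨j, by omega⟩) (ε ⟨j + 1, hj⟩) ∧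
            phi (ε ⟨j, by omega⟩) (ε ⟨j + 1, hj⟩)
              < nth (fun i => (σ i : ℝ)) (k ⟨j + 1, by omega⟩) := by
  obtain ⟨⟨p, ε, hWp⟩, hdeg, hopt⟩ := hW
  set x : Fin m → ℝ := fun i => (σ i : ℝ) with hx
  have h0 : ∀ i, 0 ≤ x i := fun i => (σ i).2.1
  have hmono : StrictMono x := fun i i' h => hσ h
  have hinj := hmono.injective
  have hcard : Fintype.card (Fin n) < Fintype.card (Fin m) := by simpa using hnm
  have : Nonempty (Fin n) := ⟨⟨0, by omega⟩⟩
  -- the channel of a clustering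
  let cp : (Fin m → Fin n) → stdSimplex ℝ (Fin n) := fun s =>
    ⟨clusterMass q.1 s, clusterMass_nonneg hq, (sum_clusterMass (q := q.1)).trans q.2.2⟩
  let ce : (Fin m → Fin n) → Fin n → Set.Icc (0 : ℝ) 1 := fun s j =>
    ⟨clusterMean q.1 x s j, clusterMean_nonneg hq h0 j,
      (clusterMean_le hq hσ' j).trans (by norm_num)⟩
  have hsorted : ∀ s : Fin m → Fin n, IsMaxClustering q.1 x s →
      StrictMono (clusterMean q.1 x s) → Monotone s := fun s hs hsm i i' hii => by
    rcases hii.eq_or_lt with rfl | hlt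
    · exact le_rfl
    · by_cases heq : s i = s i'
      · exact heq.le
      · exact (hsm.lt_iff_lt.1 (hs.clusterMean_lt hq h0 hσ' hinj hcard (hmono hlt) heq)).le
  -- C-optimality enters here only: a best clustering, sorted, is a P*-degradation, so `W` is at
  -- least as good as every clustering.
  have hcap : ∀ s : Fin m → Fin n, clusterValue q.1 x s
      ≤ ∑ j, p.1 j * negCrossEntropy (min (ε j : ℝ) (1 - ε j)) (min (ε j : ℝ) (1 - ε j)) := by
    obtain ⟨s₀, hs₀⟩ := exists_isMaxClustering (κ := Fin n) q.1 x
    obtain ⟨π, hmax, hsm⟩ := hs₀.exists_perm hq h0 hσ' hinj (by simpa using hnm)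
    have hc := hopt (cp (π.symm ∘ s₀)) (ce (π.symm ∘ s₀))
      (isPStarDegradation_of_monotone hq h0 hσ' (hsorted _ hmax hsm)
        (hmax.surjective hq h0 hσ' hinj hcard) hsm (by omega))
    rw [hWp.symmCapacity_eq, Channel.bscMix_symmCapacity, Channel.bscMix_symmCapacity,
      add_le_add_iff_left, div_le_div_iff_of_pos_right (Real.log_pos one_lt_two)] at hc
    intro s
    refine (hmax s).trans (hc.trans (sum_le_sum fun j _ => ?_))
    rcases min_choice (ε j : ℝ) (1 - ε j) with h | h
    · rw [h]
    · rw [h]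
      -- Folding preserves the value because h(1 - e) = h(e).
      refine le_of_eq ?_
      unfold negCrossEntropy
      rw [sub_sub_cancel]
      ring
  obtain ⟨t, ht, hrow, hcol, hmean⟩ := hdeg.exists_folded_transport hWp hQ hq hσ'
  obtain ⟨s₁, hs₁, hps, hεs⟩ := exists_isMaxClustering_of_transport hq h0 hσ' hinj hcard ht
    (fun j => le_min (ε j).2.1 (by linarith [(ε j).2.2]))
    (fun j => by
      rcases le_total (ε j : ℝ) (1 / 2) with h | h
      · exact (min_le_left _ _).trans h
      · exact (min_le_right _ _).trans (by linarith)) hrow hcol hmean hcap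
  obtain ⟨π, hmax, hsm⟩ := hs₁.exists_perm hq h0 hσ' hinj (by simpa using hnm)
  set s := π.symm ∘ s₁ with hs
  have hg := hsorted s hmax hsm
  have hsurj := hmax.surjective hq h0 hσ' hinj hcard
  refine ⟨fun j => clusterStart s j, clusterStart_zero, clusterStart_last,
    Fin.strictMono_iff_lt_succ.2 fun j => by simpa using clusterStart_lt_succ hg hsurj j,
    cp s, ce s, isDPlus_clusterStart hq h0 hσ' hg, fun e he => (hWp e he).trans
      (Channel.bscMix_equivalent π (fun j => ?_) (fun j => ?_) e he), fun j hj hpos => ?_⟩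
  · change clusterMass q.1 s j = p.1 (π j)
    rw [hs, clusterMass_perm, hps]
  · have h2 : (ce s j : ℝ) = min (ε (π j) : ℝ) (1 - ε (π j)) := by
      change clusterMean q.1 x s j = _
      rw [hs, clusterMean_perm, ← hεs]
    rw [h2]
    exact min_choice _ _
  · have hpos' : 0 < clusterMean q.1 x s ⟨j, by omega⟩ := hpos
    have hlt : clusterMean q.1 x s ⟨j, by omega⟩ < clusterMean q.1 x s ⟨j + 1, hj⟩ :=
      hsm (Fin.mk_lt_mk.2 (Nat.lt_succ_self j))
    have hle := clusterMean_le hq hσ' (s := s) ⟨j + 1, hj⟩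
    have hlt1 : clusterMean q.1 x s ⟨j + 1, hj⟩ < 1 := hle.trans_lt (by norm_num)
    have a1 := clusterStart_lt_succ hg hsurj ⟨j, by omega⟩
    have a2 := clusterStart_lt_succ hg hsurj ⟨j + 1, hj⟩
    have a3 := one_le_clusterStart (g := s) j
    have a4 := clusterStart_le (g := s) (j + 1 + 1)
    simp only at a1 a2
    -- the last element of the lower cluster and the first element of the upper one
    let i : Fin m := ⟨clusterStart s (j + 1) - 1 - 1, by omega⟩
    let i' : Fin m := ⟨clusterStart s (j + 1) - 1, by omega⟩
    have hi : (i : ℕ) + 1 = clusterStart s (j + 1) - 1 := by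
      simp only [i]
      omega
    have hi' : (i' : ℕ) + 1 = clusterStart s (j + 1) := by
      simp only [i']
      omega
    have hsi : s i = ⟨j, by omega⟩ := by
      have b1 := (clusterStart_le_iff hg (i := i) (j := j)).1 (by omega)
      have b2 := (clusterStart_le_iff hg (i := i) (j := j + 1)).not.1 (by omega)
      exact Fin.ext (by simp only; omega)
    have hsi' : s i' = ⟨j + 1, hj⟩ := by
      have b1 := (clusterStart_le_iff hg (i := i') (j := j + 1)).1 (by omega)
      have b2 := (clusterStart_le_iff hg (i := i') (j := j + 1 + 1)).not.1 (by omega)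
      exact Fin.ext (by simp only; omega)
    -- The two points next to the boundary strictly prefer their own centers, which places them on
    -- opposite sides of the crossing. Positivity of the lower center makes it admissible for `i'`.
    have c1 := hmax.negCrossEntropy_lt hq h0 hσ' hinj hcard (i := i) (j := ⟨j + 1, hj⟩)
      (by simp [hsi]) fun h => absurd h (hpos'.trans hlt).ne'
    have c2 := hmax.negCrossEntropy_lt hq h0 hσ' hinj hcard (i := i') (j := ⟨j, by omega⟩)
      (by simp [hsi']) fun h => absurd h hpos'.ne'
    rw [hsi, negCrossEntropy_lt_iff_lt_phi hpos' hlt hlt1, ← nth_succ x, hi] at c1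
    rw [hsi', lt_negCrossEntropy_iff_phi_lt hpos' hlt hlt1, ← nth_succ x, hi'] at c2
    exact ⟨c1, c2⟩
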